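/- Let $k\in\{0,1,2,\dots\}$ and let $L^*$ be the space of continuous functions $f:[0,\infty)\to\mathbb R$ with $f(0)=0$ that have a weak derivative $f'$ (equivalently, in this setting, are locally absolutely continuous) and satisfy $\int_0^\infty\big[(f'(x))^2+x^{\frac1{2k+1}}f(x)^2\big]dx<\infty$. For $\beta>0$ and a standard Brownian motion $W$ on $[0,\infty)$, let $$TW_{\beta,k}:=\sup_{f\in L^*,\ \|f\|_{2}=1}\ \left\{\frac{2}{\sqrt\beta}\int_0^\infty f(x)^2x^{-\frac{k}{2k+1}}\,dW_x-\int_0^\infty\Big[(f'(x))^2+x^{\frac1{2k+1}}f(x)^2\Big]dx\right\},$$ where the stochastic integral is defined path by path through integration by parts: with $g(x)=f(x)^2x^{-k/(2k+1)}$, $$\int_0^\infty g\,dW=\lim_{R\to\infty}\Big(g(R)W_R-\int_0^R g'(x)W_x\,dx\Big),$$ a limit which almost surely exists for all $f\in L^*$ simultaneously (the supremum is taken over the $f$ for which it exists). The law of $TW_{\beta,k}$ (the $k$-th higher order Tracy–Widom($\beta$) law) is that of minus the ground state eigenvalue of the operator $-\frac{d^2}{dx^2}+x^{\frac1{2k+1}}+\frac{2}{\sqrt\beta}x^{-\frac{k}{2k+1}}W'(x)$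 on the positive half-line with Dirichlet condition at $0$. Let $0<\beta_1<\beta_2$ and $\frac{1}{4k+3}\le s\le\frac{4k+2}{4k+3}$. Then $\beta_1^s\,TW_{\beta_1,k}\succeq\beta_2^s\,TW_{\beta_2,k}$, i.e. both sides are random variables and, whichever Brownian motions are used to define the two sides, $$\mathbb P\big(\beta_1^s\,TW_{\beta_1,k}>t\big)\ \ge\ \mathbb P\big(\beta_2^s\,TW_{\beta_2,k}>t\big)\qquad\text{for all } t\in\mathbb R.$$ -/

import Mathlib

open MeasureTheory ProbabilityTheory Filter Topology Set
open scoped NNReal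

noncomputable section

/-- The space `L*` of index `k`: functions on `[0, ∞)` vanishing at the origin, with an
`L²`-derivative (i.e. locally absolutely continuous with `f' ∈ L²`), and with
`∫₀^∞ [(f')² + x^{1/(2k+1)} f²] dx < ∞`. Only the values of `f` on `[0, ∞)` matter. -/
structure MemLStar (k : ℕ) (f : ℝ → ℝ) : Prop where
  absolutelyContinuous : ∀ R : ℝ, 0 < R → AbsolutelyContinuousOnInterval f 0 R
  map_zero : f 0 = 0
  integrableOn :
    IntegrableOn (fun x : ℝ => deriv f x ^ 2 + x ^ (1 / (2 * (k : ℝ) + 1)) * f x ^ 2) (Ioi 0)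

/-- The energy `∫₀^∞ [(f')² + x^{1/(2k+1)} f²] dx`. -/
def energy (k : ℕ) (f : ℝ → ℝ) : ℝ :=
  ∫ x in Ioi (0 : ℝ), (deriv f x ^ 2 + x ^ (1 / (2 * (k : ℝ) + 1)) * f x ^ 2)

/-- The Wiener integral `∫₀^R g dw` of a deterministic, absolutely continuous integrand `g` with
`g 0 = 0` along a continuous path `w`, read as a Stieltjes integral through integration by parts. -/
def wienerIntegralUpTo (w : ℝ≥0 → ℝ) (g : ℝ → ℝ) (R : ℝ) : ℝ :=
  g R * w R.toNNReal - ∫ x in (0 : ℝ)..R, deriv g x * w x.toNNReal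

/-- `∫₀^∞ g dw` exists, as the limit of `∫₀^R g dw` as `R → ∞`, and equals `c`. -/
def HasWienerIntegral (w : ℝ≥0 → ℝ) (g : ℝ → ℝ) (c : ℝ) : Prop :=
  Tendsto (wienerIntegralUpTo w g) atTop (𝓝 c)

/-- The supremum over `f ∈ L*` with `‖f‖₂ = 1` of
`(2/√β) ∫₀^∞ f² x^{-k/(2k+1)} dw - ∫₀^∞ [(f')² + x^{1/(2k+1)} f²] dx`,
taken in the extended reals, so that no convention about unbounded sets enters. The number `c` is
the value of the noise integral: for almost every Brownian path it exists for all `f ∈ L*`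
simultaneously. -/
def higherTW (k : ℕ) (β : ℝ) (w : ℝ≥0 → ℝ) : EReal :=
  ⨆ (f : ℝ → ℝ) (_ : MemLStar k f) (_ : ∫ x in Ioi (0 : ℝ), f x ^ 2 = 1)
    (c : ℝ) (_ : HasWienerIntegral w (fun x => f x ^ 2 * x ^ (-(k : ℝ) / (2 * (k : ℝ) + 1))) c),
    ((2 / √β * c - energy k f : ℝ) : EReal)

/-- Stochastic domination `X ⪰ Y` of (extended) real random variables, possibly living on different
probability spaces: `ℙ(X > t) ≥ ℙ(Y > t)` for every real `t`. -/
structure StochDominates {Ω Ω' : Type*} [MeasurableSpace Ω] [MeasurableSpace Ω']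
    (X : Ω → EReal) (P : Measure Ω) (Y : Ω' → EReal) (P' : Measure Ω') : Prop where
  aemeasurable_left : AEMeasurable X P
  aemeasurable_right : AEMeasurable Y P'
  tail_le : ∀ t : ℝ, P' {ω | (t : EReal) < Y ω} ≤ P {ω | (t : EReal) < X ω}

end

/-! The comparison is pathwise. Under the `L²`-isometric dilation `f ↦ √m f(m·)`, paired with the
Brownian rescaling of the path by `m`, the kinetic energy is multiplied by `m^2`, the potential
energy by `m^(-1/(2k+1))` and the noise integral by `m^(1/2 + k/(2k+1))`. With `ρ = β₂/β₁`, choose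
`m = ρ^q` so that the noise terms, weighted by `β₁^s` and `β₂^s`, coincide. The energy terms are
then ordered as soon as both `m^2` and `m^(-1/(2k+1))` are at most `ρ^s`, and these two inequalities
between exponents are the two bounds on `s`. Hence `β₂^s` times the supremum for `w` is at most
`β₁^s` times the supremum for the rescaled `w` (`exists_rescale_mul_higherTW_le`).

Since a rescaled Brownian motion is Brownian, it remains to show that the supremum is a random
variable whose law is the same for every Brownian motion. Cutoffs reduce it to functions of bounded
support (`higherTW_eq_iSup_truncated`). There the functional is continuous in the energy and in the
`L¹` class of the derivative of the noise density, so separability leaves a countable supremum. Each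
remaining integral is a limit of expressions in countably many values of the path
(`higherTW_eq_sampledTW`), and their joint law is determined by the finite-dimensional laws. -/

/-- The integrand `f² x^{-k/(2k+1)}` of the noise integral. -/
noncomputable def noiseDensity (k : ℕ) (f : ℝ → ℝ) : ℝ → ℝ :=
  fun x => f x ^ 2 * x ^ (-(k : ℝ) / (2 * (k : ℝ) + 1))

/-! ### Regularity of functions in `L*` and of their noise densities -/

namespace MemLStar

variable {k : ℕ} {f : ℝ → ℝ}

lemma continuousOn (hf : MemLStar k f) : ContinuousOn f (Ici 0) := by
  intro x hx
  have hx' : (0 : ℝ) ≤ x := hx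
  have h := (hf.absolutelyContinuous (x + 1) (by linarith)).continuousOn
  rw [uIcc_of_le (by linarith)] at h
  have h1 := h x ⟨hx, by linarith⟩
  refine h1.mono_of_mem_nhdsWithin ?_
  rw [← Ici_inter_Iic]
  exact inter_mem self_mem_nhdsWithin (nhdsWithin_le_nhds (Iic_mem_nhds (by linarith)))

lemma ae_differentiableAt (hf : MemLStar k f) : ∀ᵐ x : ℝ, 0 < x → DifferentiableAt ℝ f x := by
  have h : ∀ n : ℕ, ∀ᵐ x : ℝ, x ∈ uIcc (0 : ℝ) (n + 1) → DifferentiableAt ℝ f x := fun n =>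
    (hf.absolutelyContinuous (n + 1) (by positivity)).ae_differentiableAt
  filter_upwards [ae_all_iff.2 h] with x hx hx0
  refine hx ⌈x⌉₊ ?_
  rw [uIcc_of_le (by positivity)]
  exact ⟨hx0.le, (Nat.le_ceil x).trans (by linarith)⟩

lemma aestronglyMeasurable (hf : MemLStar k f) :
    AEStronglyMeasurable f (volume.restrict (Ioi 0)) :=
  (hf.continuousOn.mono Ioi_subset_Ici_self).aestronglyMeasurable measurableSet_Ioi

lemma integrableOn_deriv_sq (hf : MemLStar k f) :
    IntegrableOn (fun x => deriv f x ^ 2) (Ioi 0) := by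
  refine hf.integrableOn.mono' ((measurable_deriv f).pow_const 2).aestronglyMeasurable ?_
  filter_upwards [ae_restrict_mem measurableSet_Ioi] with x hx
  have hx : 0 < x := hx
  rw [Real.norm_of_nonneg (by positivity)]
  have : 0 ≤ x ^ (1 / (2 * (k : ℝ) + 1)) * f x ^ 2 := by positivity
  linarith

lemma integrableOn_potential (hf : MemLStar k f) :
    IntegrableOn (fun x => x ^ (1 / (2 * (k : ℝ) + 1)) * f x ^ 2) (Ioi 0) := by
  have h := hf.integrableOn.sub hf.integrableOn_deriv_sq
  refine h.congr (Eventually.of_forall fun x => ?_)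
  simp

lemma energy_eq (hf : MemLStar k f) :
    energy k f = (∫ x in Ioi (0 : ℝ), deriv f x ^ 2) +
      ∫ x in Ioi (0 : ℝ), x ^ (1 / (2 * (k : ℝ) + 1)) * f x ^ 2 :=
  integral_add hf.integrableOn_deriv_sq hf.integrableOn_potential

/-- Cauchy–Schwarz for `f x = ∫₀ˣ f'`, obtained by expanding `∫ (f' - m)² ≥ 0` with `m` the mean
slope `f x / x`. -/
lemma sq_le (hf : MemLStar k f) {x : ℝ} (hx : 0 < x) :
    f x ^ 2 ≤ x * ∫ y in Ioi (0 : ℝ), deriv f y ^ 2 := by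
  have hac := hf.absolutelyContinuous x hx
  have hft := hac.integral_deriv_eq_sub
  rw [hf.map_zero, sub_zero] at hft
  have hi := hac.intervalIntegrable_deriv
  have hsq : IntervalIntegrable (fun y => deriv f y ^ 2) volume 0 x := by
    rw [intervalIntegrable_iff_integrableOn_Ioc_of_le hx.le]
    exact hf.integrableOn_deriv_sq.mono_set Ioc_subset_Ioi_self
  set m := f x / x with hm
  have h0 : 0 ≤ ∫ y in (0 : ℝ)..x, (deriv f y - m) ^ 2 :=
    intervalIntegral.integral_nonneg hx.le fun y _ => sq_nonneg _
  have h1 : ∫ y in (0 : ℝ)..x, (deriv f y - m) ^ 2 =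
      (∫ y in (0 : ℝ)..x, deriv f y ^ 2) - 2 * m * f x + m ^ 2 * x := by
    have : ∀ y, (deriv f y - m) ^ 2 = (deriv f y ^ 2 - 2 * m * deriv f y) + m ^ 2 := by
      intro y; ring
    simp_rw [this]
    rw [intervalIntegral.integral_add (hsq.sub (hi.const_mul _)) (by simp),
      intervalIntegral.integral_sub hsq (hi.const_mul _), intervalIntegral.integral_const_mul, hft]
    simp; ring
  have h2 : ∫ y in (0 : ℝ)..x, deriv f y ^ 2 ≤ ∫ y in Ioi (0 : ℝ), deriv f y ^ 2 := by
    rw [intervalIntegral.integral_of_le hx.le]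
    exact setIntegral_mono_set hf.integrableOn_deriv_sq
      (Eventually.of_forall fun y => sq_nonneg _) (LE.le.eventuallyLE Ioc_subset_Ioi_self)
  have h3 : m * x = f x := by rw [hm]; field_simp
  have h4 : f x ^ 2 / x ≤ ∫ y in Ioi (0 : ℝ), deriv f y ^ 2 := by
    have : f x ^ 2 / x = m * f x := by rw [hm]; ring
    have h5 : m ^ 2 * x = m * f x := by rw [pow_two, mul_assoc, h3]
    rw [this]; linarith
  rw [div_le_iff₀ hx] at h4
  linarith

lemma hasDerivAt_noiseDensity {x : ℝ} (hx : 0 < x) (hd : DifferentiableAt ℝ f x) :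
    HasDerivAt (noiseDensity k f)
      (2 * f x * deriv f x * x ^ (-(k : ℝ) / (2 * (k : ℝ) + 1)) +
        f x ^ 2 * (-(k : ℝ) / (2 * (k : ℝ) + 1) * x ^ (-(k : ℝ) / (2 * (k : ℝ) + 1) - 1))) x := by
  have h := (hd.hasDerivAt.pow 2).mul
    (Real.hasDerivAt_rpow_const (p := -(k : ℝ) / (2 * (k : ℝ) + 1)) (Or.inl hx.ne'))
  refine h.congr_deriv ?_
  simp

/-- Only the singularity at `0` matters. With `α = -k/(2k+1)` and `f² ≤ C x`, the term `2 f f' x^α`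
is at most `f'² + C x^(1+2α)` by AM–GM, and `α f² x^(α-1)` is at most `C |α| x^α`. Both powers are
integrable because `α > -1` and `1 + 2α > 0`. -/
lemma integrableOn_deriv_noiseDensity (hf : MemLStar k f) (M : ℝ) :
    IntegrableOn (deriv (noiseDensity k f)) (Ioc 0 M) := by
  rcases le_or_gt M 0 with hM | hM
  · simp [Ioc_eq_empty_of_le hM]
  set α : ℝ := -(k : ℝ) / (2 * (k : ℝ) + 1) with hα
  have hk : (0 : ℝ) ≤ k := k.cast_nonneg
  have hα1 : -1 < α := by rw [hα, lt_div_iff₀ (by positivity)]; linarith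
  have hα2 : 0 < 1 + 2 * α := by
    rw [hα]
    have : 1 + 2 * (-(k : ℝ) / (2 * (k : ℝ) + 1)) = 1 / (2 * (k : ℝ) + 1) := by field_simp; ring
    rw [this]; positivity
  set C := ∫ y in Ioi (0 : ℝ), deriv f y ^ 2 with hC
  have hrp : ∀ r : ℝ, -1 < r → IntegrableOn (fun x : ℝ => x ^ r) (Ioc 0 M) := fun r hr => by
    rw [← intervalIntegrable_iff_integrableOn_Ioc_of_le hM.le]
    exact intervalIntegral.intervalIntegrable_rpow' hr
  have hbound : IntegrableOn (fun x : ℝ => deriv f x ^ 2 + C * x ^ (1 + 2 * α) +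
      C * |α| * x ^ α) (Ioc 0 M) :=
    ((hf.integrableOn_deriv_sq.mono_set Ioc_subset_Ioi_self).add
      ((hrp _ (by linarith)).const_mul _)).add ((hrp _ hα1).const_mul _)
  refine hbound.mono' (measurable_deriv _).aestronglyMeasurable ?_
  filter_upwards [ae_restrict_mem measurableSet_Ioc, ae_restrict_of_ae hf.ae_differentiableAt]
    with x hx hd
  have hx0 : 0 < x := hx.1
  rw [(hasDerivAt_noiseDensity hx0 (hd hx0)).deriv, ← hα]
  have hs := hf.sq_le hx0
  rw [← hC] at hs
  have e1 : x * x ^ (2 * α) = x ^ (1 + 2 * α) := by rw [Real.rpow_add hx0, Real.rpow_one]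
  have e2 : x * x ^ (α - 1) = x ^ α := by
    rw [Real.rpow_sub_one hx0.ne']; field_simp
  have e3 : (x ^ α) ^ 2 = x ^ (2 * α) := by
    rw [← Real.rpow_natCast, ← Real.rpow_mul hx0.le]; ring_nf
  have b1 : |2 * f x * deriv f x * x ^ α| ≤ deriv f x ^ 2 + C * x ^ (1 + 2 * α) := by
    have h1 : |2 * f x * deriv f x * x ^ α| ≤ deriv f x ^ 2 + f x ^ 2 * x ^ (2 * α) := by
      rw [abs_le, ← e3]
      constructor
      · nlinarith [sq_nonneg (deriv f x + f x * x ^ α)]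
      · nlinarith [sq_nonneg (deriv f x - f x * x ^ α)]
    have h2 : f x ^ 2 * x ^ (2 * α) ≤ x * C * x ^ (2 * α) := by gcongr
    have h3 : x * C * x ^ (2 * α) = C * x ^ (1 + 2 * α) := by rw [← e1]; ring
    linarith
  have b2 : |f x ^ 2 * (α * x ^ (α - 1))| ≤ C * |α| * x ^ α := by
    rw [abs_mul, abs_mul, abs_of_nonneg (sq_nonneg (f x)),
      abs_of_nonneg (Real.rpow_nonneg hx0.le _)]
    calc f x ^ 2 * (|α| * x ^ (α - 1)) ≤ x * C * (|α| * x ^ (α - 1)) := by gcongr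
      _ = C * |α| * x ^ α := by rw [← e2]; ring
  exact (abs_add_le _ _).trans (by linarith)

lemma const_mul (hf : MemLStar k f) (r : ℝ) : MemLStar k (fun x => r * f x) where
  absolutelyContinuous R hR := (hf.absolutelyContinuous R hR).const_mul r
  map_zero := by simp [hf.map_zero]
  integrableOn := by
    refine (hf.integrableOn.const_mul (r ^ 2)).congr (Eventually.of_forall fun x => ?_)
    simp only [deriv_const_mul_field]; ring

end MemLStar

lemma energy_const_mul (k : ℕ) (f : ℝ → ℝ) (r : ℝ) :
    energy k (fun x => r * f x) = r ^ 2 * energy k f := by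
  unfold energy
  rw [← integral_const_mul]
  congr 1
  ext x
  simp only [deriv_const_mul_field]; ring

lemma noiseDensity_const_mul (k : ℕ) (f : ℝ → ℝ) (r : ℝ) :
    noiseDensity k (fun x => r * f x) = fun x => r ^ 2 * noiseDensity k f x := by
  ext x; simp only [noiseDensity]; ring

/-! ### Smooth cutoffs -/

lemma Real.smoothTransition.exists_abs_deriv_le :
    ∃ C : ℝ, 0 ≤ C ∧ ∀ x, |deriv Real.smoothTransition x| ≤ C := by
  have hc : Continuous (deriv Real.smoothTransition) :=
    (Real.smoothTransition.contDiff (n := 1)).continuous_deriv le_rfl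
  obtain ⟨C, hC⟩ := isCompact_Icc.exists_bound_of_continuousOn (s := Icc (0 : ℝ) 1) hc.continuousOn
  refine ⟨C, (norm_nonneg _).trans (hC 0 (by simp)), fun x => ?_⟩
  rcases lt_or_ge x 0 with hx | hx
  · have : Real.smoothTransition =ᶠ[𝓝 x] fun _ => 0 := by
      filter_upwards [Iio_mem_nhds hx] with y hy
      exact Real.smoothTransition.zero_of_nonpos (le_of_lt hy)
    rw [this.deriv_eq, deriv_const, abs_zero]
    exact (norm_nonneg _).trans (hC 0 (by simp))
  rcases lt_or_ge 1 x with hx1 | hx1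
  · have : Real.smoothTransition =ᶠ[𝓝 x] fun _ => 1 := by
      filter_upwards [Ioi_mem_nhds hx1] with y hy
      exact Real.smoothTransition.one_of_one_le (le_of_lt hy)
    rw [this.deriv_eq, deriv_const, abs_zero]
    exact (norm_nonneg _).trans (hC 0 (by simp))
  · exact hC x ⟨hx, hx1⟩

/-- A smooth cutoff, equal to `1` on `(-∞, R]` and to `0` on `[2R, ∞)`. -/
noncomputable def cutoff (R x : ℝ) : ℝ := Real.smoothTransition (2 - x / R)

section cutoff

variable {R x : ℝ}

lemma cutoff_of_le (hR : 0 < R) (hx : x ≤ R) : cutoff R x = 1 := by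
  refine Real.smoothTransition.one_of_one_le ?_
  have : x / R ≤ 1 := (div_le_one hR).2 hx
  linarith

lemma cutoff_of_ge (hR : 0 < R) (hx : 2 * R ≤ x) : cutoff R x = 0 := by
  refine Real.smoothTransition.zero_of_nonpos ?_
  have : 2 ≤ x / R := (le_div_iff₀ hR).2 hx
  linarith

lemma cutoff_nonneg (R x : ℝ) : 0 ≤ cutoff R x := Real.smoothTransition.nonneg _

lemma cutoff_le_one (R x : ℝ) : cutoff R x ≤ 1 := Real.smoothTransition.le_one _

lemma contDiff_cutoff (R : ℝ) : ContDiff ℝ 1 (cutoff R) :=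
  (Real.smoothTransition.contDiff (n := 1)).comp (contDiff_const.sub (contDiff_id.div_const R))

lemma differentiable_cutoff (R : ℝ) : Differentiable ℝ (cutoff R) :=
  (contDiff_cutoff R).differentiable (by simp)

lemma continuous_cutoff (R : ℝ) : Continuous (cutoff R) := (contDiff_cutoff R).continuous

lemma deriv_cutoff (R x : ℝ) :
    deriv (cutoff R) x = -(deriv Real.smoothTransition (2 - x / R) / R) := by
  have h1 : HasDerivAt (fun y : ℝ => 2 - y / R) (-(1 / R)) x := by
    simpa using ((hasDerivAt_id x).div_const R).const_sub 2
  have h2 : HasDerivAt Real.smoothTransition (deriv Real.smoothTransition (2 - x / R))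
      (2 - x / R) :=
    (((Real.smoothTransition.contDiff (n := 1)).differentiable (by simp)) _).hasDerivAt
  have h3 := (h2.comp x h1).deriv
  have h4 : (Real.smoothTransition ∘ fun y : ℝ => 2 - y / R) = cutoff R := rfl
  rw [h4] at h3
  rw [h3]; ring

lemma exists_abs_deriv_cutoff_le : ∃ C : ℝ, 0 ≤ C ∧ ∀ R x, 0 < R → |deriv (cutoff R) x| ≤ C / R := by
  obtain ⟨C, hC0, hC⟩ := Real.smoothTransition.exists_abs_deriv_le
  refine ⟨C, hC0, fun R x hR => ?_⟩
  rw [deriv_cutoff, abs_neg, abs_div, abs_of_pos hR]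
  gcongr
  exact hC _

lemma cutoff_eventuallyEq_one (hR : 0 < R) (hx : x < R) : cutoff R =ᶠ[𝓝 x] fun _ => 1 := by
  filter_upwards [Iio_mem_nhds hx] with y hy
  exact cutoff_of_le hR (le_of_lt hy)

end cutoff

/-- The squared cutoff. -/
noncomputable def cutoffSq (R x : ℝ) : ℝ := cutoff R x ^ 2

lemma contDiff_cutoffSq (R : ℝ) : ContDiff ℝ 1 (cutoffSq R) := (contDiff_cutoff R).pow 2

lemma hasDerivAt_cutoffSq (R x : ℝ) :
    HasDerivAt (cutoffSq R) (2 * cutoff R x * deriv (cutoff R) x) x := by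
  refine ((differentiable_cutoff R x).hasDerivAt.pow 2).congr_deriv ?_
  simp

lemma noiseDensity_mul_cutoff (k : ℕ) (f : ℝ → ℝ) (R x : ℝ) :
    noiseDensity k (fun y => f y * cutoff R y) x = noiseDensity k f x * cutoffSq R x := by
  simp only [noiseDensity, cutoffSq]; ring

/-! ### The noise integral under truncation -/

namespace MemLStar

variable {k : ℕ} {f : ℝ → ℝ}

lemma continuousOn_noiseDensity (hf : MemLStar k f) : ContinuousOn (noiseDensity k f) (Ioi 0) := by
  refine ((hf.continuousOn.mono Ioi_subset_Ici_self).pow 2).mul fun x hx => ?_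
  exact (Real.continuousAt_rpow_const _ _ (Or.inl (ne_of_gt hx))).continuousWithinAt

lemma intervalIntegrable_deriv_noiseDensity (hf : MemLStar k f) {a b : ℝ} (ha : 0 ≤ a)
    (hab : a ≤ b) : IntervalIntegrable (deriv (noiseDensity k f)) volume a b := by
  rw [intervalIntegrable_iff_integrableOn_Ioc_of_le hab]
  exact (hf.integrableOn_deriv_noiseDensity b).mono_set (Ioc_subset_Ioc_left ha)

/-- Integration by parts: the noise integral of a truncated function is an average of the partial
noise integrals of the function itself. -/
lemma integral_deriv_noiseDensity_mul_cutoff (hf : MemLStar k f) {w : ℝ → ℝ} (hw : Continuous w)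
    {R : ℝ} (hR : 0 < R) :
    ∫ x in (0 : ℝ)..(2 * R), deriv (noiseDensity k (fun y => f y * cutoff R y)) x * w x =
      ∫ x in R..(2 * R), deriv (cutoffSq R) x *
        (noiseDensity k f x * w x - ∫ y in (0 : ℝ)..x, deriv (noiseDensity k f) y * w y) := by
  set g := noiseDensity k f with hg
  set G : ℝ → ℝ := fun x => ∫ y in (0 : ℝ)..x, deriv g y * w y with hG
  have hR2 : R ≤ 2 * R := by linarith
  have hgw : ∀ a b : ℝ, 0 ≤ a → a ≤ b → IntervalIntegrable (fun x => deriv g x * w x) volume a b :=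
    fun a b ha hab => (hf.intervalIntegrable_deriv_noiseDensity ha hab).mul_continuousOn
      hw.continuousOn
  have hGac : AbsolutelyContinuousOnInterval G R (2 * R) := by
    refine ((hgw 0 (2 * R) le_rfl (by linarith)).absolutelyContinuousOnInterval_intervalIntegral
      (c := 0) left_mem_uIcc).mono ?_
    rw [uIcc_of_le hR2, uIcc_of_le (by linarith)]
    exact Icc_subset_Icc_left hR.le
  have hψac : AbsolutelyContinuousOnInterval (cutoffSq R) R (2 * R) :=
    (contDiff_cutoffSq R).contDiffOn.absolutelyContinuousOnInterval
  have hψc : Continuous (deriv (cutoffSq R)) := (contDiff_cutoffSq R).continuous_deriv le_rfl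
  have hgc : ContinuousOn g (uIcc R (2 * R)) := by
    refine hf.continuousOn_noiseDensity.mono ?_
    rw [uIcc_of_le hR2]
    exact fun x hx => hR.trans_le hx.1
  have hderiv : ∀ᵐ x : ℝ, 0 < x → deriv (noiseDensity k (fun y => f y * cutoff R y)) x =
      deriv g x * cutoffSq R x + g x * deriv (cutoffSq R) x := by
    filter_upwards [hf.ae_differentiableAt] with x hx hx0
    have h1 := (hasDerivAt_noiseDensity (k := k) hx0 (hx hx0)).differentiableAt.hasDerivAt
    have h2 := (h1.mul (hasDerivAt_cutoffSq R x).differentiableAt.hasDerivAt).deriv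
    rw [← h2]
    congr 1
    ext y
    exact noiseDensity_mul_cutoff k f R y
  have hψ1 : ∀ x ≤ R, cutoffSq R x = 1 := fun x hx => by simp [cutoffSq, cutoff_of_le hR hx]
  have hψ'1 : ∀ x < R, deriv (cutoffSq R) x = 0 := fun x hx => by
    rw [(hasDerivAt_cutoffSq R x).deriv, (cutoff_eventuallyEq_one hR hx).deriv_eq]; simp
  have hA : ∫ x in (0 : ℝ)..(2 * R), deriv (noiseDensity k (fun y => f y * cutoff R y)) x * w x =
      ∫ x in (0 : ℝ)..(2 * R), (deriv g x * cutoffSq R x + g x * deriv (cutoffSq R) x) * w x := by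
    refine intervalIntegral.integral_congr_ae ?_
    filter_upwards [hderiv] with x hx hx'
    rw [uIoc_of_le (by linarith)] at hx'
    rw [hx hx'.1]
  have hB : EqOn (fun x => deriv g x * w x)
      (fun x => (deriv g x * cutoffSq R x + g x * deriv (cutoffSq R) x) * w x) (Ioo 0 R) := by
    intro x hx
    simp only [hψ1 x hx.2.le, hψ'1 x hx.2]; ring
  have hBae : ∀ᵐ x : ℝ, x ∈ uIoc 0 R → (fun x => deriv g x * w x) x =
      (fun x => (deriv g x * cutoffSq R x + g x * deriv (cutoffSq R) x) * w x) x := by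
    have : ∀ᵐ x : ℝ, x ≠ R := by simp [ae_iff, measure_singleton]
    filter_upwards [this] with x hx hx'
    rw [uIoc_of_le hR.le] at hx'
    exact hB ⟨hx'.1, lt_of_le_of_ne hx'.2 hx⟩
  have hI0 : IntervalIntegrable
      (fun x => (deriv g x * cutoffSq R x + g x * deriv (cutoffSq R) x) * w x) volume 0 R := by
    refine (hgw 0 R le_rfl hR.le).congr_ae ?_
    rw [EventuallyEq, ae_restrict_iff' measurableSet_uIoc]
    exact hBae
  have i1 : IntervalIntegrable (fun x => cutoffSq R x * (deriv g x * w x)) volume R (2 * R) :=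
    (hgw R (2 * R) hR.le hR2).continuousOn_mul (contDiff_cutoffSq R).continuous.continuousOn
  have i2 : IntervalIntegrable (fun x => deriv (cutoffSq R) x * (g x * w x)) volume R (2 * R) :=
    (hψc.continuousOn.mul (hgc.mul hw.continuousOn)).intervalIntegrable
  have i3 : IntervalIntegrable (fun x => deriv (cutoffSq R) x * G x) volume R (2 * R) :=
    (hψc.continuousOn.mul hGac.continuousOn).intervalIntegrable
  have hI1 : ∀ x, (deriv g x * cutoffSq R x + g x * deriv (cutoffSq R) x) * w x =
      cutoffSq R x * (deriv g x * w x) + deriv (cutoffSq R) x * (g x * w x) := fun x => by ring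
  have hGd : ∫ x in R..(2 * R), cutoffSq R x * deriv G x =
      ∫ x in R..(2 * R), cutoffSq R x * (deriv g x * w x) := by
    refine intervalIntegral.integral_congr_ae ?_
    filter_upwards [(hgw 0 (2 * R) le_rfl (by linarith)).ae_hasDerivAt_integral] with x hx hx'
    rw [uIoc_of_le hR2] at hx'
    have h0 : uIcc 0 (2 * R) = Icc 0 (2 * R) := uIcc_of_le (by linarith)
    rw [h0] at hx
    rw [(hx ⟨hR.le.trans hx'.1.le, hx'.2⟩ 0 ⟨le_rfl, by linarith⟩).deriv]
  -- The squared cutoff is `1` at `R` and `0` at `2R`, so the only boundary term is `-G R`; it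
  -- cancels the integral over `[0, R]`.
  have hparts := hψac.integral_mul_deriv_eq_deriv_mul hGac
  rw [hGd, hψ1 R le_rfl, show cutoffSq R (2 * R) = 0 by simp [cutoffSq, cutoff_of_ge hR le_rfl]]
    at hparts
  rw [hA, ← intervalIntegral.integral_add_adjacent_intervals hI0
    (by simp_rw [hI1]; exact i1.add i2), ← intervalIntegral.integral_congr_ae hBae]
  simp_rw [hI1]
  rw [intervalIntegral.integral_add i1 i2, hparts]
  simp_rw [mul_sub]
  rw [intervalIntegral.integral_sub i2 i3]
  simp only [hG]
  ring

/-- Truncation does not affect the noise integral in the limit. -/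
lemma tendsto_noise_mul_cutoff (hf : MemLStar k f) {w : ℝ≥0 → ℝ} (hw : Continuous w) {c : ℝ}
    (hc : HasWienerIntegral w (noiseDensity k f) c) :
    Tendsto (fun R : ℝ => -∫ x in (0 : ℝ)..(2 * R),
      deriv (noiseDensity k (fun y => f y * cutoff R y)) x * w x.toNNReal) atTop (𝓝 c) := by
  obtain ⟨C, hC0, hC⟩ := exists_abs_deriv_cutoff_le
  rw [Metric.tendsto_atTop]
  intro ε hε
  -- The weight is at most `2C/R` in absolute value on an interval of length `R`, so its total
  -- variation is at most `2C`. The extra `1` makes the final bound strict and covers `C = 0`.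
  have hc' := Metric.tendsto_atTop.1 hc (ε / (2 * C + 1)) (by positivity)
  obtain ⟨N, hN⟩ := hc'
  refine ⟨max N 1, fun R hRN => ?_⟩
  have hR : 0 < R := lt_of_lt_of_le one_pos ((le_max_right _ _).trans hRN)
  have hR2 : R ≤ 2 * R := by linarith
  have hw' : Continuous fun x : ℝ => w x.toNNReal := hw.comp continuous_real_toNNReal
  rw [hf.integral_deriv_noiseDensity_mul_cutoff hw' hR]
  have hψc : Continuous (deriv (cutoffSq R)) := (contDiff_cutoffSq R).continuous_deriv le_rfl
  -- The averaging weight, minus the derivative of the squared cutoff, has total mass `1`, so the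
  -- constant `c` can be moved under the integral.
  have hone : ∫ x in R..(2 * R), deriv (cutoffSq R) x = -1 := by
    rw [intervalIntegral.integral_deriv_eq_sub
      (fun x _ => (hasDerivAt_cutoffSq R x).differentiableAt) (hψc.intervalIntegrable _ _)]
    simp [cutoffSq, cutoff_of_le hR le_rfl, cutoff_of_ge hR le_rfl]
  have hIc : IntervalIntegrable (fun x => deriv (cutoffSq R) x *
      wienerIntegralUpTo w (noiseDensity k f) x) volume R (2 * R) := by
    refine ContinuousOn.intervalIntegrable (hψc.continuousOn.mul (ContinuousOn.sub
      (ContinuousOn.mul ?_ hw'.continuousOn) ?_))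
    · refine hf.continuousOn_noiseDensity.mono ?_
      rw [uIcc_of_le hR2]
      exact fun x hx => hR.trans_le hx.1
    · refine (intervalIntegral.continuousOn_primitive_interval (a := 0) (b := 2 * R) ?_).mono ?_
      · rw [uIcc_of_le (by linarith), integrableOn_Icc_iff_integrableOn_Ioc,
          ← intervalIntegrable_iff_integrableOn_Ioc_of_le (by linarith)]
        exact (hf.intervalIntegrable_deriv_noiseDensity le_rfl (by linarith)).mul_continuousOn
          hw'.continuousOn
      · rw [uIcc_of_le hR2, uIcc_of_le (by linarith)]
        exact Icc_subset_Icc_left hR.le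
  have key : (-∫ x in R..(2 * R), deriv (cutoffSq R) x *
      wienerIntegralUpTo w (noiseDensity k f) x) - c =
      -∫ x in R..(2 * R), deriv (cutoffSq R) x *
        (wienerIntegralUpTo w (noiseDensity k f) x - c) := by
    simp_rw [mul_sub]
    rw [intervalIntegral.integral_sub hIc ((hψc.intervalIntegrable _ _).mul_const c),
      intervalIntegral.integral_mul_const, hone]
    ring
  change dist (-∫ x in R..(2 * R), deriv (cutoffSq R) x *
      wienerIntegralUpTo w (noiseDensity k f) x) c < ε
  rw [Real.dist_eq, key, abs_neg, ← Real.norm_eq_abs]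
  have hb : ∀ x ∈ uIoc R (2 * R), ‖deriv (cutoffSq R) x *
      (wienerIntegralUpTo w (noiseDensity k f) x - c)‖ ≤ (2 * (C / R)) * (ε / (2 * C + 1)) := by
    intro x hx
    rw [uIoc_of_le hR2] at hx
    rw [norm_mul]
    have h1 : ‖deriv (cutoffSq R) x‖ ≤ 2 * (C / R) := by
      rw [(hasDerivAt_cutoffSq R x).deriv, Real.norm_eq_abs, abs_mul, abs_mul, abs_two,
        abs_of_nonneg (cutoff_nonneg R x)]
      calc 2 * cutoff R x * |deriv (cutoff R) x| ≤ 2 * 1 * (C / R) := by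
            gcongr
            · exact cutoff_le_one R x
            · exact hC R x hR
        _ = _ := by ring
    have h2 := (hN x (((le_max_left _ _).trans hRN).trans hx.1.le)).le
    rw [Real.dist_eq, ← Real.norm_eq_abs] at h2
    gcongr
  refine (intervalIntegral.norm_integral_le_of_norm_le_const hb).trans_lt ?_
  rw [show 2 * R - R = R by ring, abs_of_pos hR]
  have : 2 * (C / R) * (ε / (2 * C + 1)) * R = ε * (2 * C / (2 * C + 1)) := by field_simp
  rw [this]
  have : 2 * C / (2 * C + 1) < 1 := by rw [div_lt_one (by positivity)]; linarith
  nlinarith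

end MemLStar

/-! ### Energy and norm under truncation -/

namespace MemLStar

variable {k : ℕ} {f : ℝ → ℝ}

lemma deriv_mul_cutoff_ae (hf : MemLStar k f) (R : ℝ) : ∀ᵐ x : ℝ, 0 < x →
    deriv (fun y => f y * cutoff R y) x = deriv f x * cutoff R x + f x * deriv (cutoff R) x := by
  filter_upwards [hf.ae_differentiableAt] with x hx hx0
  exact ((hx hx0).hasDerivAt.mul (differentiable_cutoff R x).hasDerivAt).deriv

/-- The product rule and `(a + b)² ≤ 2a² + 2b²` give a bound depending on `R` only through `C`,
hence one dominating function for all the truncations. -/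
lemma energyDensity_mul_cutoff_le {x d C R : ℝ} (hx : 0 < x)
    (hd : |deriv (cutoff R) x| ≤ C) :
    (d * cutoff R x + f x * deriv (cutoff R) x) ^ 2 +
      x ^ (1 / (2 * (k : ℝ) + 1)) * (f x * cutoff R x) ^ 2 ≤
    2 * d ^ 2 + 2 * C ^ 2 * f x ^ 2 + x ^ (1 / (2 * (k : ℝ) + 1)) * f x ^ 2 := by
  have h0 := cutoff_nonneg R x
  have h1 := cutoff_le_one R x
  have hc2 : cutoff R x ^ 2 ≤ 1 := pow_le_one₀ h0 h1
  have hd2 : deriv (cutoff R) x ^ 2 ≤ C ^ 2 := by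
    rw [← sq_abs]; gcongr
  have e1 : (d * cutoff R x + f x * deriv (cutoff R) x) ^ 2 ≤
      2 * (d ^ 2 * cutoff R x ^ 2) + 2 * (f x ^ 2 * deriv (cutoff R) x ^ 2) := by
    nlinarith [sq_nonneg (d * cutoff R x - f x * deriv (cutoff R) x)]
  have e2 : d ^ 2 * cutoff R x ^ 2 ≤ d ^ 2 * 1 := by gcongr
  have e3 : f x ^ 2 * deriv (cutoff R) x ^ 2 ≤ f x ^ 2 * C ^ 2 := by gcongr
  have e4 : x ^ (1 / (2 * (k : ℝ) + 1)) * (f x * cutoff R x) ^ 2 ≤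
      x ^ (1 / (2 * (k : ℝ) + 1)) * f x ^ 2 := by
    rw [mul_pow]
    have : f x ^ 2 * cutoff R x ^ 2 ≤ f x ^ 2 * 1 := by gcongr
    gcongr; linarith
  linarith

lemma aestronglyMeasurable_energyDensity (hf : ContinuousOn f (Ici 0)) :
    AEStronglyMeasurable (fun x : ℝ => deriv f x ^ 2 + x ^ (1 / (2 * (k : ℝ) + 1)) * f x ^ 2)
      (volume.restrict (Ioi 0)) := by
  have h2 : AEStronglyMeasurable f (volume.restrict (Ioi 0)) :=
    (hf.mono Ioi_subset_Ici_self).aestronglyMeasurable measurableSet_Ioi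
  exact ((measurable_deriv f).pow_const 2).aestronglyMeasurable.add
    ((measurable_id.pow_const _).aestronglyMeasurable.mul (h2.pow 2))

lemma continuousOn_mul_cutoff (hf : MemLStar k f) (R : ℝ) :
    ContinuousOn (fun y => f y * cutoff R y) (Ici 0) :=
  hf.continuousOn.mul (continuous_cutoff R).continuousOn

lemma integrable_energy_bound (hf : MemLStar k f) (hf2 : IntegrableOn (fun x => f x ^ 2) (Ioi 0))
    (C : ℝ) : IntegrableOn (fun x : ℝ => 2 * deriv f x ^ 2 + 2 * C ^ 2 * f x ^ 2 +
      x ^ (1 / (2 * (k : ℝ) + 1)) * f x ^ 2) (Ioi 0) :=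
  ((hf.integrableOn_deriv_sq.const_mul _).add (hf2.const_mul _)).add hf.integrableOn_potential

lemma norm_energyDensity_mul_cutoff_le_ae (hf : MemLStar k f) {C R : ℝ}
    (hd : ∀ x, |deriv (cutoff R) x| ≤ C) : ∀ᵐ x ∂volume.restrict (Ioi (0 : ℝ)),
    ‖deriv (fun y => f y * cutoff R y) x ^ 2 +
      x ^ (1 / (2 * (k : ℝ) + 1)) * (f x * cutoff R x) ^ 2‖ ≤
    2 * deriv f x ^ 2 + 2 * C ^ 2 * f x ^ 2 + x ^ (1 / (2 * (k : ℝ) + 1)) * f x ^ 2 := by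
  filter_upwards [ae_restrict_mem measurableSet_Ioi,
    ae_restrict_of_ae (hf.deriv_mul_cutoff_ae R)] with x hx hd'
  have hx : 0 < x := hx
  rw [Real.norm_of_nonneg (by positivity), hd' hx]
  exact energyDensity_mul_cutoff_le hx (hd x)

lemma mul_cutoff (hf : MemLStar k f) (hf2 : IntegrableOn (fun x => f x ^ 2) (Ioi 0))
    {R : ℝ} (hR : 0 < R) : MemLStar k (fun x => f x * cutoff R x) where
  absolutelyContinuous S hS := (hf.absolutelyContinuous S hS).fun_mul
    (contDiff_cutoff R).contDiffOn.absolutelyContinuousOnInterval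
  map_zero := by simp [hf.map_zero]
  integrableOn := by
    obtain ⟨C, hC0, hC⟩ := exists_abs_deriv_cutoff_le
    exact (hf.integrable_energy_bound hf2 (C / R)).mono'
      (aestronglyMeasurable_energyDensity (hf.continuousOn_mul_cutoff R))
      (hf.norm_energyDensity_mul_cutoff_le_ae fun x => hC R x hR)

lemma tendsto_energy_mul_cutoff (hf : MemLStar k f)
    (hf2 : IntegrableOn (fun x => f x ^ 2) (Ioi 0)) :
    Tendsto (fun n : ℕ => energy k (fun x => f x * cutoff (n + 1) x)) atTop
      (𝓝 (energy k f)) := by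
  obtain ⟨C, hC0, hC⟩ := exists_abs_deriv_cutoff_le
  refine tendsto_integral_of_dominated_convergence _
    (fun n => aestronglyMeasurable_energyDensity (hf.continuousOn_mul_cutoff _))
    (hf.integrable_energy_bound hf2 C)
    -- The cutoff radius `n + 1` is at least `1`, so `C / R ≤ C` uniformly in `n`.
    (fun n => hf.norm_energyDensity_mul_cutoff_le_ae fun x =>
      (hC _ x (by positivity)).trans (div_le_self hC0 (by simp))) ?_
  refine Eventually.of_forall fun x => tendsto_const_nhds.congr' ?_
  filter_upwards [eventually_ge_atTop ⌈x⌉₊] with n hn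
  have hx : x < (n : ℝ) + 1 := by
    have := (Nat.le_ceil x).trans (Nat.cast_le.2 hn)
    linarith
  have h1 := cutoff_eventuallyEq_one (by positivity) hx
  have h2 : (fun y => f y * cutoff ((n : ℝ) + 1) y) =ᶠ[𝓝 x] f := by
    filter_upwards [h1] with y hy
    simp [hy]
  rw [h2.deriv_eq, h1.eq_of_nhds, mul_one]

lemma tendsto_sq_mul_cutoff (hf : MemLStar k f)
    (hf2 : IntegrableOn (fun x => f x ^ 2) (Ioi 0)) :
    Tendsto (fun n : ℕ => ∫ x in Ioi (0 : ℝ), (f x * cutoff (n + 1) x) ^ 2) atTop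
      (𝓝 (∫ x in Ioi (0 : ℝ), f x ^ 2)) := by
  refine tendsto_integral_of_dominated_convergence (fun x => f x ^ 2)
    (fun n => ((hf.aestronglyMeasurable.mul
      (continuous_cutoff _).aestronglyMeasurable).pow 2)) hf2
    (fun n => Eventually.of_forall fun x => ?_) (Eventually.of_forall fun x => ?_)
  · rw [Real.norm_of_nonneg (by positivity), mul_pow]
    exact mul_le_of_le_one_right (sq_nonneg _)
      (pow_le_one₀ (cutoff_nonneg _ _) (cutoff_le_one _ _))
  · refine tendsto_const_nhds.congr' ?_
    filter_upwards [eventually_ge_atTop ⌈x⌉₊] with n hn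
    have hx : x ≤ (n : ℝ) + 1 := by
      have := (Nat.le_ceil x).trans (Nat.cast_le.2 hn)
      linarith
    rw [cutoff_of_le (by positivity) hx, mul_one]

end MemLStar

/-! ### Reduction to bounded support -/

/-- The normalized elements of `L*` that vanish on `[M, ∞)`. -/
def unitLStar (k : ℕ) (M : ℝ) : Set (ℝ → ℝ) :=
  {f | MemLStar k f ∧ ∫ x in Ioi (0 : ℝ), f x ^ 2 = 1 ∧ ∀ x ≥ M, f x = 0}

/-- The functional whose supremum is `higherTW`, in terms of the energy `p.1` and of the derivative
`p.2` of the noise density, for functions vanishing on `[M, ∞)`. -/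
noncomputable def truncatedFunctional (β M : ℝ) (w : ℝ → ℝ) (p : ℝ × (ℝ → ℝ)) : ℝ :=
  2 / √β * (-∫ x in Ioc 0 M, p.2 x * w x) - p.1

lemma deriv_noiseDensity_of_gt {k : ℕ} {f : ℝ → ℝ} {M x : ℝ} (hf : ∀ x ≥ M, f x = 0)
    (hx : M < x) : deriv (noiseDensity k f) x = 0 := by
  have : noiseDensity k f =ᶠ[𝓝 x] fun _ => 0 := by
    filter_upwards [Ioi_mem_nhds hx] with y hy
    simp [noiseDensity, hf y (le_of_lt hy)]
  rw [this.deriv_eq, deriv_const]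

lemma hasWienerIntegral_of_mem_unitLStar {k : ℕ} {M : ℝ} (hM : 0 ≤ M) {f : ℝ → ℝ}
    (hf : f ∈ unitLStar k M) {w : ℝ≥0 → ℝ} (hw : Continuous w) :
    HasWienerIntegral w (noiseDensity k f)
      (-∫ x in Ioc 0 M, deriv (noiseDensity k f) x * w x.toNNReal) := by
  have hw' : Continuous fun x : ℝ => w x.toNNReal := hw.comp continuous_real_toNNReal
  have hint : ∀ a b : ℝ, 0 ≤ a → a ≤ b →
      IntervalIntegrable (fun x => deriv (noiseDensity k f) x * w x.toNNReal) volume a b :=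
    fun a b ha hab => (hf.1.intervalIntegrable_deriv_noiseDensity ha hab).mul_continuousOn
      hw'.continuousOn
  refine tendsto_const_nhds.congr' ?_
  filter_upwards [eventually_ge_atTop M] with R hR
  rw [wienerIntegralUpTo, ← intervalIntegral.integral_of_le hM,
    ← intervalIntegral.integral_add_adjacent_intervals (hint 0 M le_rfl hM) (hint M R hM hR)]
  have h0 : ∫ x in M..R, deriv (noiseDensity k f) x * w x.toNNReal = 0 := by
    rw [intervalIntegral.integral_of_le hR]
    refine setIntegral_eq_zero_of_forall_eq_zero fun x hx => ?_
    rw [deriv_noiseDensity_of_gt hf.2.2 hx.1, zero_mul]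
  rw [h0]
  simp [noiseDensity, hf.2.2 R hR]

/-- Along a continuous path, the supremum may be restricted to functions of bounded support. -/
theorem higherTW_eq_iSup_truncated (k : ℕ) (β : ℝ) {w : ℝ≥0 → ℝ} (hw : Continuous w) :
    higherTW k β w = ⨆ (M : ℕ) (f ∈ unitLStar k M),
      ((truncatedFunctional β M (fun x => w x.toNNReal)
        (energy k f, deriv (noiseDensity k f)) : ℝ) : EReal) := by
  apply le_antisymm
  · refine iSup_le fun f => iSup_le fun hf => iSup_le fun hf1 => iSup_le fun c => iSup_le fun hc => ?_
    have hf2 : IntegrableOn (fun x => f x ^ 2) (Ioi 0) := by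
      -- The integral of a non-integrable function is `0` by convention, so norm `1` forces square
      -- integrability.
      by_contra h
      rw [integral_undef h] at hf1
      exact zero_ne_one hf1
    have hnorm := hf.tendsto_sq_mul_cutoff hf2
    rw [hf1] at hnorm
    have hen := hf.tendsto_energy_mul_cutoff hf2
    have hnoise := (hf.tendsto_noise_mul_cutoff hw hc).comp
      (tendsto_atTop_add_const_right atTop (1 : ℝ) (tendsto_natCast_atTop_atTop (R := ℝ)))
    have hlim := (((hnoise.const_mul (2 / √β)).sub hen).div hnorm one_ne_zero)
    rw [div_one] at hlim
    -- The value at `f` is the limit of the functional at the truncations divided by their squared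
    -- norm. The functional is quadratic, so each quotient is its value at a normalized truncation.
    refine le_of_tendsto ((continuous_coe_real_ereal.tendsto _).comp hlim) ?_
    filter_upwards [hnorm.eventually (lt_mem_nhds one_pos)] with n hn
    set R : ℝ := (n : ℝ) + 1 with hR
    have hR0 : 0 < R := by positivity
    set N := ∫ x in Ioi (0 : ℝ), (f x * cutoff R x) ^ 2 with hN
    set r := (√N)⁻¹ with hr
    have hr2 : r ^ 2 = N⁻¹ := by rw [hr, inv_pow, Real.sq_sqrt hn.le]
    set h : ℝ → ℝ := fun x => r * (f x * cutoff R x) with hh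
    have hmem : h ∈ unitLStar k ((2 * (n + 1) : ℕ) : ℝ) := by
      refine ⟨(hf.mul_cutoff hf2 hR0).const_mul r, ?_, fun x hx => ?_⟩
      · simp only [hh, mul_pow r]
        rw [integral_const_mul, hr2, ← hN, inv_mul_cancel₀ hn.ne']
      · have : cutoff R x = 0 := cutoff_of_ge hR0 (by push_cast at hx; linarith)
        simp [hh, this]
    refine le_trans (le_of_eq ?_) (le_iSup_of_le (2 * (n + 1)) (le_iSup₂_of_le h hmem le_rfl))
    simp only [Function.comp_apply, Pi.div_apply, EReal.coe_eq_coe_iff, truncatedFunctional]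
    rw [hh, energy_const_mul, noiseDensity_const_mul, hr2]
    simp only [deriv_const_mul_field, mul_assoc]
    rw [integral_const_mul, ← intervalIntegral.integral_of_le (by positivity)]
    push_cast
    rw [← hR, ← hN]
    field_simp
  · refine iSup_le fun M => iSup₂_le fun f hf => ?_
    exact le_iSup_of_le f (le_iSup_of_le hf.1 (le_iSup_of_le hf.2.1 (le_iSup₂_of_le _
      (hasWienerIntegral_of_mem_unitLStar M.cast_nonneg hf hw) le_rfl)))

/-! ### Reduction to a countable supremum -/

/-- The pairs formed by the energy of `f` and the derivative of its noise density, for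
`f ∈ unitLStar k M`, in `ℝ × L¹(0, M)`. -/
def noiseData (k : ℕ) (M : ℝ) : Set (ℝ × Lp ℝ 1 (volume.restrict (Ioc 0 M))) :=
  {p | ∃ f ∈ unitLStar k M, p.1 = energy k f ∧
    p.2 =ᵐ[volume.restrict (Ioc 0 M)] deriv (noiseDensity k f)}

lemma truncatedFunctional_congr {β M : ℝ} {w : ℝ → ℝ} {e : ℝ} {g h : ℝ → ℝ}
    (hgh : g =ᵐ[volume.restrict (Ioc 0 M)] h) :
    truncatedFunctional β M w (e, g) = truncatedFunctional β M w (e, h) := by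
  have : ∫ x in Ioc 0 M, g x * w x = ∫ x in Ioc 0 M, h x * w x :=
    integral_congr_ae (hgh.mono fun x hx => by simp only [hx])
  simp only [truncatedFunctional, this]

lemma iSup_unitLStar_eq_iSup_noiseData (k : ℕ) (β M : ℝ) (w : ℝ → ℝ) :
    ⨆ f ∈ unitLStar k M,
      ((truncatedFunctional β M w (energy k f, deriv (noiseDensity k f)) : ℝ) : EReal) =
    ⨆ p ∈ noiseData k M, ((truncatedFunctional β M w (p.1, p.2) : ℝ) : EReal) := by
  apply le_antisymm
  · refine iSup₂_le fun f hf => ?_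
    have hi : Integrable (deriv (noiseDensity k f)) (volume.restrict (Ioc 0 M)) :=
      hf.1.integrableOn_deriv_noiseDensity M
    have he := hi.coeFn_toL1
    refine le_iSup₂_of_le (energy k f, hi.toL1 _) ⟨f, hf, rfl, he⟩ (le_of_eq ?_)
    rw [truncatedFunctional_congr he]
  · refine iSup₂_le fun p ⟨f, hf, h1, h2⟩ => le_iSup₂_of_le f hf (le_of_eq ?_)
    rw [truncatedFunctional_congr h2, h1]

lemma exists_abs_le_of_continuous {w : ℝ → ℝ} (hw : Continuous w) (M : ℝ) :
    ∃ C : ℝ, 0 ≤ C ∧ ∀ x ∈ Icc 0 M, |w x| ≤ C := by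
  obtain ⟨C, hC⟩ := isCompact_Icc.exists_bound_of_continuousOn (s := Icc (0 : ℝ) M) hw.continuousOn
  exact ⟨max C 0, le_max_right _ _, fun x hx => (hC x hx).trans (le_max_left _ _)⟩

lemma integrable_coeFn_mul {M : ℝ} (h : Lp ℝ 1 (volume.restrict (Ioc 0 M))) {w : ℝ → ℝ}
    (hw : Continuous w) : Integrable (fun x => h x * w x) (volume.restrict (Ioc 0 M)) := by
  obtain ⟨C, -, hC⟩ := exists_abs_le_of_continuous hw M
  refine (L1.integrable_coeFn h).mul_bdd (c := C) hw.aestronglyMeasurable ?_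
  filter_upwards [ae_restrict_mem measurableSet_Ioc] with x hx
  exact hC x (Ioc_subset_Icc_self hx)

lemma continuous_integral_coeFn_mul (M : ℝ) {w : ℝ → ℝ} (hw : Continuous w) :
    Continuous fun h : Lp ℝ 1 (volume.restrict (Ioc 0 M)) => ∫ x in Ioc 0 M, h x * w x := by
  obtain ⟨C, hC0, hC⟩ := exists_abs_le_of_continuous hw M
  let L : Lp ℝ 1 (volume.restrict (Ioc 0 M)) →ₗ[ℝ] ℝ :=
    { toFun := fun h => ∫ x in Ioc 0 M, h x * w x
      map_add' := fun h₁ h₂ => by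
        rw [← integral_add (integrable_coeFn_mul h₁ hw) (integrable_coeFn_mul h₂ hw)]
        refine integral_congr_ae ((Lp.coeFn_add h₁ h₂).mono fun x hx => ?_)
        simp only [hx, Pi.add_apply]; ring
      map_smul' := fun r h => by
        simp only [RingHom.id_apply, smul_eq_mul]
        rw [← integral_const_mul]
        refine integral_congr_ae ((Lp.coeFn_smul r h).mono fun x hx => ?_)
        simp only [hx, Pi.smul_apply, smul_eq_mul]; ring }
  refine (L.mkContinuous C fun h => ?_).continuous
  rw [L1.norm_eq_integral_norm, ← integral_const_mul]
  refine norm_integral_le_of_norm_le ((L1.integrable_coeFn h).norm.const_mul C) ?_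
  filter_upwards [ae_restrict_mem measurableSet_Ioc] with x hx
  rw [norm_mul, mul_comm]
  gcongr
  exact hC x (Ioc_subset_Icc_self hx)

/-- The energy is an independent coordinate, so no continuity in `f` is needed; the noise term is a
bounded functional on `L¹` because the path is bounded on `[0, M]`. -/
lemma continuous_truncatedFunctional (β M : ℝ) {w : ℝ → ℝ} (hw : Continuous w) :
    Continuous fun p : ℝ × Lp ℝ 1 (volume.restrict (Ioc 0 M)) =>
      truncatedFunctional β M w (p.1, p.2) := by
  unfold truncatedFunctional
  exact (continuous_const.mul ((continuous_integral_coeFn_mul M hw).comp continuous_snd).neg).sub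
    continuous_fst

lemma exists_countable_dense_noiseData (k : ℕ) (M : ℝ) :
    ∃ D ⊆ noiseData k M, D.Countable ∧ noiseData k M ⊆ closure D := by
  have : Fact ((1 : ENNReal) ≠ ⊤) := ⟨by simp⟩
  exact (TopologicalSpace.IsSeparable.of_separableSpace _).exists_countable_dense_subset

/-- A countable dense subset of `noiseData k M`. -/
noncomputable def denseNoiseData (k : ℕ) (M : ℝ) : Set (ℝ × Lp ℝ 1 (volume.restrict (Ioc 0 M))) :=
  (exists_countable_dense_noiseData k M).choose

lemma countable_denseNoiseData (k : ℕ) (M : ℝ) : (denseNoiseData k M).Countable :=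
  (exists_countable_dense_noiseData k M).choose_spec.2.1

lemma iSup_noiseData_eq_iSup_denseNoiseData (k : ℕ) (β M : ℝ) {w : ℝ → ℝ} (hw : Continuous w) :
    ⨆ p ∈ noiseData k M, ((truncatedFunctional β M w (p.1, p.2) : ℝ) : EReal) =
    ⨆ p ∈ denseNoiseData k M, ((truncatedFunctional β M w (p.1, p.2) : ℝ) : EReal) := by
  obtain ⟨hsub, -, hcl⟩ := (exists_countable_dense_noiseData k M).choose_spec
  refine le_antisymm (iSup₂_le fun p hp => ?_) (biSup_mono hsub)
  have hclosed : IsClosed {p : ℝ × Lp ℝ 1 (volume.restrict (Ioc 0 M)) |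
      ((truncatedFunctional β M w (p.1, p.2) : ℝ) : EReal) ≤
      ⨆ q ∈ denseNoiseData k M, ((truncatedFunctional β M w (q.1, q.2) : ℝ) : EReal)} :=
    isClosed_le (continuous_coe_real_ereal.comp (continuous_truncatedFunctional β M hw))
      continuous_const
  refine (closure_minimal (s := denseNoiseData k M) (fun q hq => ?_) hclosed) (hcl hp)
  exact le_iSup₂_of_le (f := fun (q : ℝ × Lp ℝ 1 (volume.restrict (Ioc 0 M)))
    (_ : q ∈ denseNoiseData k M) => ((truncatedFunctional β M w (q.1, q.2) : ℝ) : EReal))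
    q hq le_rfl

/-! ### Reduction to countably many values of the path -/

/-- The values of a path at the times `j / (n + 1)`. -/
noncomputable def sampledPath (w : ℝ≥0 → ℝ) : ℕ × ℕ → ℝ := fun i => w ((i.2 : ℝ) / ((i.1 : ℝ) + 1)).toNNReal

/-- The piecewise constant path of mesh `1 / (n + 1)` built from sampled values. -/
noncomputable def stepPath (v : ℕ × ℕ → ℝ) (n : ℕ) : ℝ → ℝ :=
  fun x => v (n, ⌊((n : ℝ) + 1) * x⌋₊)

/-- `higherTW` as a measurable function of countably many values of the path. -/
noncomputable def sampledTW (k : ℕ) (β : ℝ) (v : ℕ × ℕ → ℝ) : EReal :=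
  ⨆ (M : ℕ), ⨆ p ∈ denseNoiseData k M,
    limsup (fun n => ((truncatedFunctional β M (stepPath v n) (p.1, p.2) : ℝ) : EReal)) atTop

lemma measurable_truncatedFunctional_stepPath (β M : ℝ) (n : ℕ)
    (p : ℝ × Lp ℝ 1 (volume.restrict (Ioc 0 M))) :
    Measurable fun v : ℕ × ℕ → ℝ => truncatedFunctional β M (stepPath v n) (p.1, p.2) := by
  have hstep : Measurable fun q : (ℕ × ℕ → ℝ) × ℝ => stepPath q.1 n q.2 := by
    have h1 : Measurable fun q : (ℕ × ℕ → ℝ) × ℕ => q.1 (n, q.2) :=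
      measurable_from_prod_countable_left fun y => measurable_pi_apply (n, y)
    have h2 : Measurable fun q : (ℕ × ℕ → ℝ) × ℝ => (q.1, ⌊((n : ℝ) + 1) * q.2⌋₊) :=
      measurable_fst.prodMk (Nat.measurable_floor.comp (measurable_snd.const_mul _))
    exact h1.comp h2
  have hint : StronglyMeasurable fun v : ℕ × ℕ → ℝ =>
      ∫ x in Ioc 0 M, p.2 x * stepPath v n x := by
    refine StronglyMeasurable.integral_prod_right
      (f := fun (v : ℕ × ℕ → ℝ) (x : ℝ) => p.2 x * stepPath v n x) ?_
    exact (((Lp.stronglyMeasurable p.2).measurable.comp measurable_snd).mul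
      hstep).stronglyMeasurable
  exact (hint.measurable.neg.const_mul _).sub_const _

lemma measurable_sampledTW (k : ℕ) (β : ℝ) : Measurable (sampledTW k β) := by
  refine Measurable.iSup fun M => Measurable.biSup _ (countable_denseNoiseData k M) fun p _ => ?_
  exact Measurable.limsup fun n =>
    measurable_coe_real_ereal.comp (measurable_truncatedFunctional_stepPath β M n p)

/-- Dominated convergence: the step paths converge pointwise by continuity, and rounding times down
keeps them in `[0, M]`, where the path is bounded. -/
lemma tendsto_truncatedFunctional_stepPath (β M : ℝ) {w : ℝ≥0 → ℝ} (hw : Continuous w)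
    (p : ℝ × Lp ℝ 1 (volume.restrict (Ioc 0 M))) :
    Tendsto (fun n => truncatedFunctional β M (stepPath (sampledPath w) n) (p.1, p.2)) atTop
      (𝓝 (truncatedFunctional β M (fun x => w x.toNNReal) (p.1, p.2))) := by
  have hw' : Continuous fun x : ℝ => w x.toNNReal := hw.comp continuous_real_toNNReal
  obtain ⟨C, hC0, hC⟩ := exists_abs_le_of_continuous hw' M
  have hstep : ∀ (n : ℕ) (x : ℝ), stepPath (sampledPath w) n x =
      w ((⌊((n : ℝ) + 1) * x⌋₊ : ℝ) / ((n : ℝ) + 1)).toNNReal := fun n x => rfl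
  have hmeas : ∀ n : ℕ, Measurable (stepPath (sampledPath w) n) := fun n =>
    (measurable_of_countable fun j : ℕ => sampledPath w (n, j)).comp
      (Nat.measurable_floor.comp (measurable_id.const_mul _))
  have hint : Tendsto (fun n => ∫ x in Ioc 0 M, p.2 x * stepPath (sampledPath w) n x) atTop
      (𝓝 (∫ x in Ioc 0 M, p.2 x * w x.toNNReal)) := by
    refine tendsto_integral_of_dominated_convergence (fun x => ‖p.2 x‖ * C)
      (fun n => (Lp.aestronglyMeasurable p.2).mul (hmeas n).aestronglyMeasurable)
      ((L1.integrable_coeFn p.2).norm.mul_const C) (fun n => ?_) ?_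
    · filter_upwards [ae_restrict_mem measurableSet_Ioc] with x hx
      rw [norm_mul, hstep]
      gcongr
      refine hC _ ⟨by positivity, ?_⟩
      rw [div_le_iff₀ (by positivity)]
      refine (Nat.floor_le (mul_nonneg (by positivity) hx.1.le)).trans ?_
      rw [mul_comm]
      gcongr
      exact hx.2
    · filter_upwards [ae_restrict_mem measurableSet_Ioc] with x hx
      refine tendsto_const_nhds.mul ?_
      simp_rw [hstep]
      have h1 : Tendsto (fun n : ℕ => ((⌊x * ((n : ℝ) + 1)⌋₊ : ℝ) / ((n : ℝ) + 1))) atTop (𝓝 x) :=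
        (tendsto_nat_floor_mul_div_atTop hx.1.le).comp
          (tendsto_atTop_add_const_right atTop (1 : ℝ) tendsto_natCast_atTop_atTop)
      simp_rw [mul_comm x] at h1
      exact (hw'.tendsto x).comp h1
  exact (hint.neg.const_mul _).sub_const _

/-- For values sampled from a continuous path the limsup in `sampledTW` is a limit. The limsup keeps
`sampledTW` defined and measurable on all arrays of values. -/
theorem higherTW_eq_sampledTW (k : ℕ) (β : ℝ) {w : ℝ≥0 → ℝ} (hw : Continuous w) :
    higherTW k β w = sampledTW k β (sampledPath w) := by
  have hw' : Continuous fun x : ℝ => w x.toNNReal := hw.comp continuous_real_toNNReal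
  rw [higherTW_eq_iSup_truncated k β hw, sampledTW]
  congr 1
  ext M
  rw [iSup_unitLStar_eq_iSup_noiseData, iSup_noiseData_eq_iSup_denseNoiseData k β M hw']
  congr 1
  ext p
  congr 1
  ext _
  exact ((continuous_coe_real_ereal.tendsto _).comp
    (tendsto_truncatedFunctional_stepPath β M hw p)).limsup_eq.symm

/-! ### Measurability and uniqueness of the law -/

section Law

variable {Ω Ω' : Type*} [MeasurableSpace Ω] [MeasurableSpace Ω'] {P : Measure Ω} {P' : Measure Ω'}

open scoped Classical in
-- The family `t` may repeat times, as the sampling times `j / (n + 1)` do; the law is therefore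
-- read off the set of distinct times.
lemma ProbabilityTheory.IsPreBrownianReal.map_restrict_comp {W : ℝ≥0 → Ω → ℝ}
    (hW : IsPreBrownianReal W P) {ι : Type*} (t : ι → ℝ≥0) (I : Finset ι) :
    P.map (fun ω => I.restrict fun i => W (t i) ω) =
      (BrownianReal.projectiveFamily (I.image t)).map
        (fun x (i : I) => x ⟨t i, Finset.mem_image_of_mem t i.2⟩) := by
  rw [← (hW.hasLaw (I.image t)).map_eq, AEMeasurable.map_map_of_aemeasurable
    (measurable_pi_lambda _ fun i => measurable_pi_apply _).aemeasurable
    (hW.hasLaw _).aemeasurable]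
  rfl

lemma ProbabilityTheory.IsPreBrownianReal.aemeasurable_comp {W : ℝ≥0 → Ω → ℝ}
    (hW : IsPreBrownianReal W P) {ι : Type*} [Countable ι] (t : ι → ℝ≥0) :
    AEMeasurable (fun ω i => W (t i) ω) P :=
  aemeasurable_pi_lambda _ fun i => hW.aemeasurable (t i)

/-- Pre-Brownian motions have the same law along any countable family of times. -/
lemma ProbabilityTheory.IsPreBrownianReal.map_comp_eq {W : ℝ≥0 → Ω → ℝ} {W' : ℝ≥0 → Ω' → ℝ}
    (hW : IsPreBrownianReal W P) (hW' : IsPreBrownianReal W' P') {ι : Type*} [Countable ι]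
    (t : ι → ℝ≥0) :
    P.map (fun ω i => W (t i) ω) = P'.map (fun ω i => W' (t i) ω) := by
  have hP : IsProbabilityMeasure P := hW.isGaussianProcess.isProbabilityMeasure
  have h1 := isProjectiveLimit_map (hW.aemeasurable_comp t)
  have h2 := isProjectiveLimit_map (hW'.aemeasurable_comp t)
  simp_rw [hW'.map_restrict_comp t, ← hW.map_restrict_comp t] at h2
  -- Both laws are projective limits of the same finite-dimensional laws.
  exact h1.unique h2

end Law

section HigherTW

variable {Ω Ω' : Type*} [MeasurableSpace Ω] [MeasurableSpace Ω'] {P : Measure Ω} {P' : Measure Ω'}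
  {W : ℝ≥0 → Ω → ℝ} {W' : ℝ≥0 → Ω' → ℝ}

lemma higherTW_ae_eq (hW : IsBrownianReal W P) (k : ℕ) (β : ℝ) :
    (fun ω => higherTW k β (fun x => W x ω)) =ᵐ[P]
      fun ω => sampledTW k β (sampledPath fun x => W x ω) := by
  filter_upwards [hW.cont] with ω hω
  exact higherTW_eq_sampledTW k β hω

lemma aemeasurable_mul_higherTW (hW : IsBrownianReal W P) (k : ℕ) (β r : ℝ) :
    AEMeasurable (fun ω => (r : EReal) * higherTW k β (fun x => W x ω)) P :=
  (((measurable_sampledTW k β).comp_aemeasurable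
    (hW.toIsPreBrownianReal.aemeasurable_comp _)).congr (higherTW_ae_eq hW k β).symm).const_mul _

/-- The law of `higherTW` does not depend on the choice of the Brownian motion. -/
lemma measure_lt_mul_higherTW_eq (hW : IsBrownianReal W P) (hW' : IsBrownianReal W' P') (k : ℕ)
    (β r t : ℝ) :
    P {ω | (t : EReal) < r * higherTW k β (fun x => W x ω)} =
      P' {ω | (t : EReal) < r * higherTW k β (fun x => W' x ω)} := by
  have hmeas : MeasurableSet {v : ℕ × ℕ → ℝ | (t : EReal) < r * sampledTW k β v} :=
    measurableSet_lt measurable_const ((measurable_sampledTW k β).const_mul _)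
  have h := hW.toIsPreBrownianReal.map_comp_eq hW'.toIsPreBrownianReal
    (fun i : ℕ × ℕ => ((i.2 : ℝ) / ((i.1 : ℝ) + 1)).toNNReal)
  have h1 := congrArg (fun μ => μ {v : ℕ × ℕ → ℝ | (t : EReal) < r * sampledTW k β v}) h
  rw [Measure.map_apply_of_aemeasurable (hW.toIsPreBrownianReal.aemeasurable_comp _) hmeas,
    Measure.map_apply_of_aemeasurable (hW'.toIsPreBrownianReal.aemeasurable_comp _) hmeas] at h1
  refine (measure_congr ?_).trans (h1.trans (measure_congr ?_).symm)
  · filter_upwards [higherTW_ae_eq hW k β] with ω hω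
    change ((t : EReal) < r * higherTW k β fun x => W x ω) =
      ((t : EReal) < r * sampledTW k β (sampledPath fun x => W x ω))
    rw [hω]
  · filter_upwards [higherTW_ae_eq hW' k β] with ω hω
    change ((t : EReal) < r * higherTW k β fun x => W' x ω) =
      ((t : EReal) < r * sampledTW k β (sampledPath fun x => W' x ω))
    rw [hω]

end HigherTW

/-! ### Dilation and Brownian scaling -/

lemma AbsolutelyContinuousOnInterval.comp_mul_left {f : ℝ → ℝ} {m R : ℝ} (hm : 0 < m) (hR : 0 ≤ R)
    (hf : AbsolutelyContinuousOnInterval f 0 (m * R)) :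
    AbsolutelyContinuousOnInterval (fun x => f (m * x)) 0 R := by
  rw [absolutelyContinuousOnInterval_iff] at hf ⊢
  intro ε hε
  obtain ⟨δ, hδ, h⟩ := hf ε hε
  refine ⟨δ / m, by positivity, fun E hE hlt => ?_⟩
  refine h (E.1, fun i => (m * (E.2 i).1, m * (E.2 i).2)) ⟨fun i hi => ?_, ?_⟩ ?_
  · have := hE.1 i hi
    rw [uIcc_of_le hR] at this
    rw [uIcc_of_le (by positivity)]
    refine ⟨⟨mul_nonneg hm.le this.1.1, ?_⟩, ⟨mul_nonneg hm.le this.2.1, ?_⟩⟩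
    · exact mul_le_mul_of_nonneg_left this.1.2 hm.le
    · exact mul_le_mul_of_nonneg_left this.2.2 hm.le
  · intro i hi j hj hij
    have hd := hE.2 hi hj hij
    rw [Function.onFun, Set.disjoint_left] at hd ⊢
    have hmem : ∀ (a b x : ℝ), x ∈ uIoc (m * a) (m * b) → x / m ∈ uIoc a b := by
      intro a b x hx
      rw [mem_uIoc] at hx ⊢
      rcases hx with hx | hx
      · left; rw [lt_div_iff₀ hm, div_le_iff₀ hm, mul_comm a, mul_comm b]; exact hx
      · right; rw [lt_div_iff₀ hm, div_le_iff₀ hm, mul_comm a, mul_comm b]; exact hx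
    exact fun x hx hx' => hd (hmem _ _ _ hx) (hmem _ _ _ hx')
  · rw [lt_div_iff₀ hm, Finset.sum_mul] at hlt
    refine lt_of_eq_of_lt (Finset.sum_congr rfl fun i _ => ?_) hlt
    simp only [Real.dist_eq, ← mul_sub, abs_mul, abs_of_pos hm]
    ring

/-- The `L²`-isometric dilation of `f` by `m`. -/
noncomputable def dilate (m : ℝ) (f : ℝ → ℝ) : ℝ → ℝ := fun x => √m * f (m * x)

section dilate

variable {k : ℕ} {f : ℝ → ℝ} {m : ℝ}

lemma deriv_dilate_sq (hm : 0 < m) (f : ℝ → ℝ) (x : ℝ) :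
    deriv (dilate m f) x ^ 2 = m ^ 3 * deriv f (m * x) ^ 2 := by
  unfold dilate
  rw [deriv_const_mul_field, deriv_comp_mul_left, mul_pow, Real.sq_sqrt hm.le, smul_eq_mul]
  ring

lemma potential_dilate (hm : 0 < m) (b : ℝ) (f : ℝ → ℝ) {x : ℝ} (hx : 0 < x) :
    x ^ b * dilate m f x ^ 2 = m ^ (-b) * m * ((m * x) ^ b * f (m * x) ^ 2) := by
  unfold dilate
  rw [mul_pow, Real.sq_sqrt hm.le, Real.mul_rpow hm.le hx.le, Real.rpow_neg hm.le]
  have : m ^ b ≠ 0 := (Real.rpow_pos_of_pos hm b).ne'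
  field_simp

lemma integral_dilate_sq (hm : 0 < m) (f : ℝ → ℝ) :
    ∫ x in Ioi (0 : ℝ), dilate m f x ^ 2 = ∫ x in Ioi (0 : ℝ), f x ^ 2 := by
  have : ∀ x, dilate m f x ^ 2 = m * f (m * x) ^ 2 := fun x => by
    rw [dilate, mul_pow, Real.sq_sqrt hm.le]
  simp_rw [this]
  rw [integral_const_mul, integral_comp_mul_left_Ioi (fun x => f x ^ 2) 0 hm, mul_zero, smul_eq_mul,
    mul_inv_cancel_left₀ hm.ne']

lemma integral_deriv_dilate_sq (hm : 0 < m) (f : ℝ → ℝ) :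
    ∫ x in Ioi (0 : ℝ), deriv (dilate m f) x ^ 2 = m ^ 2 * ∫ x in Ioi (0 : ℝ), deriv f x ^ 2 := by
  simp_rw [deriv_dilate_sq hm]
  rw [integral_const_mul, integral_comp_mul_left_Ioi (fun x => deriv f x ^ 2) 0 hm, mul_zero,
    smul_eq_mul]
  field_simp

lemma integral_potential_dilate (hm : 0 < m) (b : ℝ) (f : ℝ → ℝ) :
    ∫ x in Ioi (0 : ℝ), x ^ b * dilate m f x ^ 2 =
      m ^ (-b) * ∫ x in Ioi (0 : ℝ), x ^ b * f x ^ 2 := by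
  rw [setIntegral_congr_fun measurableSet_Ioi fun x hx => potential_dilate hm b f hx,
    integral_const_mul, integral_comp_mul_left_Ioi (fun x => x ^ b * f x ^ 2) 0 hm, mul_zero,
    smul_eq_mul, mul_assoc, mul_inv_cancel_left₀ hm.ne']

lemma MemLStar.dilate (hf : MemLStar k f) (hm : 0 < m) : MemLStar k (dilate m f) where
  absolutelyContinuous R hR :=
    ((hf.absolutelyContinuous (m * R) (by positivity)).comp_mul_left hm hR.le).const_mul _
  map_zero := by simp [_root_.dilate, hf.map_zero]
  integrableOn := by
    have h1 : IntegrableOn (fun x => m ^ 3 * deriv f (m * x) ^ 2) (Ioi 0) := by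
      refine Integrable.const_mul
        ((integrableOn_Ioi_comp_mul_left_iff (fun x => deriv f x ^ 2) 0 hm).2 ?_) _
      rw [mul_zero]
      exact hf.integrableOn_deriv_sq
    have h2 : IntegrableOn (fun x => m ^ (-(1 / (2 * (k : ℝ) + 1))) * m *
        ((m * x) ^ (1 / (2 * (k : ℝ) + 1)) * f (m * x) ^ 2)) (Ioi 0) := by
      refine Integrable.const_mul ((integrableOn_Ioi_comp_mul_left_iff
        (fun x => x ^ (1 / (2 * (k : ℝ) + 1)) * f x ^ 2) 0 hm).2 ?_) _
      rw [mul_zero]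
      exact hf.integrableOn_potential
    refine (h1.add h2).congr_fun (fun x hx => ?_) measurableSet_Ioi
    simp only [Pi.add_apply]
    rw [deriv_dilate_sq hm, potential_dilate hm _ f hx]

lemma energy_dilate (hf : MemLStar k f) (hm : 0 < m) :
    energy k (dilate m f) = m ^ 2 * (∫ x in Ioi (0 : ℝ), deriv f x ^ 2) +
      m ^ (-(1 / (2 * (k : ℝ) + 1))) *
        ∫ x in Ioi (0 : ℝ), x ^ (1 / (2 * (k : ℝ) + 1)) * f x ^ 2 := by
  rw [(hf.dilate hm).energy_eq, integral_deriv_dilate_sq hm, integral_potential_dilate hm]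

lemma noiseDensity_dilate (hm : 0 < m) (k : ℕ) (f : ℝ → ℝ) {x : ℝ} (hx : 0 < x) :
    noiseDensity k (dilate m f) x =
      m ^ (1 + (k : ℝ) / (2 * (k : ℝ) + 1)) * noiseDensity k f (m * x) := by
  simp only [noiseDensity, dilate]
  rw [mul_pow, Real.sq_sqrt hm.le, Real.mul_rpow hm.le hx.le, Real.rpow_add hm, Real.rpow_one,
    neg_div, Real.rpow_neg hm.le]
  have : m ^ ((k : ℝ) / (2 * (k : ℝ) + 1)) ≠ 0 := (Real.rpow_pos_of_pos hm _).ne'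
  field_simp

lemma deriv_noiseDensity_dilate (hm : 0 < m) (k : ℕ) (f : ℝ → ℝ) {x : ℝ} (hx : 0 < x) :
    deriv (noiseDensity k (dilate m f)) x =
      m ^ (1 + (k : ℝ) / (2 * (k : ℝ) + 1)) * (m * deriv (noiseDensity k f) (m * x)) := by
  have : noiseDensity k (dilate m f) =ᶠ[𝓝 x] fun y =>
      m ^ (1 + (k : ℝ) / (2 * (k : ℝ) + 1)) * noiseDensity k f (m * y) := by
    filter_upwards [Ioi_mem_nhds hx] with y hy
    exact noiseDensity_dilate hm k f hy
  rw [this.deriv_eq, deriv_const_mul_field, deriv_comp_mul_left, smul_eq_mul]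

/-- The Brownian rescaling of a path. -/
noncomputable def rescale (m : ℝ≥0) (w : ℝ≥0 → ℝ) : ℝ≥0 → ℝ := fun t => (√(m : ℝ))⁻¹ * w (m * t)

/-- Substitute `m x` for `x`: the density contributes `m^(1 + k/(2k+1))` and the path `m^(-1/2)`,
while the `m` from differentiating cancels the Jacobian. -/
lemma wienerIntegralUpTo_dilate {m : ℝ≥0} (hm : 0 < m) (k : ℕ) (f : ℝ → ℝ) (w : ℝ≥0 → ℝ) {R : ℝ}
    (hR : 0 < R) :
    wienerIntegralUpTo (rescale m w) (noiseDensity k (dilate m f)) R =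
      (m : ℝ) ^ (1 + (k : ℝ) / (2 * (k : ℝ) + 1)) * (√(m : ℝ))⁻¹ *
        wienerIntegralUpTo w (noiseDensity k f) (m * R) := by
  have hm' : (0 : ℝ) < m := hm
  have hw : ∀ x : ℝ, rescale m w x.toNNReal = (√(m : ℝ))⁻¹ * w ((m : ℝ) * x).toNNReal := fun x => by
    rw [rescale, Real.toNNReal_mul m.coe_nonneg, Real.toNNReal_coe]
  have hint : ∫ x in (0 : ℝ)..R, deriv (noiseDensity k (dilate m f)) x * rescale m w x.toNNReal =
      (m : ℝ) ^ (1 + (k : ℝ) / (2 * (k : ℝ) + 1)) * (√(m : ℝ))⁻¹ *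
        ∫ x in (0 : ℝ)..(m * R), deriv (noiseDensity k f) x * w x.toNNReal := by
    have h1 : ∫ x in (0 : ℝ)..R, deriv (noiseDensity k (dilate m f)) x * rescale m w x.toNNReal =
        ∫ x in (0 : ℝ)..R, (m : ℝ) ^ (1 + (k : ℝ) / (2 * (k : ℝ) + 1)) * (√(m : ℝ))⁻¹ * (m : ℝ) *
          (deriv (noiseDensity k f) (m * x) * w ((m : ℝ) * x).toNNReal) := by
      refine intervalIntegral.integral_congr_ae (Eventually.of_forall fun x hx => ?_)
      rw [uIoc_of_le hR.le] at hx
      rw [deriv_noiseDensity_dilate hm' k f hx.1, hw]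
      ring
    rw [h1, intervalIntegral.integral_const_mul,
      intervalIntegral.integral_comp_mul_left
        (fun x => deriv (noiseDensity k f) x * w x.toNNReal) hm'.ne', mul_zero, smul_eq_mul]
    field_simp
  rw [wienerIntegralUpTo, wienerIntegralUpTo, hint, noiseDensity_dilate hm' k f hR, hw]
  ring

lemma HasWienerIntegral.dilate {m : ℝ≥0} (hm : 0 < m) {w : ℝ≥0 → ℝ} {c : ℝ}
    (hc : HasWienerIntegral w (noiseDensity k f) c) :
    HasWienerIntegral (rescale m w) (noiseDensity k (dilate m f))
      ((m : ℝ) ^ (1 / 2 + (k : ℝ) / (2 * (k : ℝ) + 1)) * c) := by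
  have hm' : (0 : ℝ) < m := hm
  have hcoef : (m : ℝ) ^ (1 / 2 + (k : ℝ) / (2 * (k : ℝ) + 1)) =
      (m : ℝ) ^ (1 + (k : ℝ) / (2 * (k : ℝ) + 1)) * (√(m : ℝ))⁻¹ := by
    rw [Real.sqrt_eq_rpow, ← Real.rpow_neg hm'.le, ← Real.rpow_add hm']
    ring_nf
  rw [hcoef]
  refine ((hc.comp (tendsto_id.const_mul_atTop hm')).const_mul _).congr' ?_
  filter_upwards [eventually_gt_atTop 0] with R hR
  exact (wienerIntegralUpTo_dilate hm k f w hR).symm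

end dilate

/-! ### The comparison -/

/-- The pathwise form of the comparison: after Brownian rescaling, the noise terms agree and the
energy terms are ordered. -/
theorem exists_rescale_mul_higherTW_le (k : ℕ) {β₁ β₂ s : ℝ} (hβ₁ : 0 < β₁) (hβ : β₁ < β₂)
    (hs₁ : 1 / (4 * (k : ℝ) + 3) ≤ s) (hs₂ : s ≤ (4 * (k : ℝ) + 2) / (4 * (k : ℝ) + 3)) :
    ∃ m : ℝ≥0, 0 < m ∧ ∀ w : ℝ≥0 → ℝ, ((β₂ ^ s : ℝ) : EReal) * higherTW k β₂ w ≤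
      ((β₁ ^ s : ℝ) : EReal) * higherTW k β₁ (rescale m w) := by
  have hβ₂ : 0 < β₂ := hβ₁.trans hβ
  have hk : (0 : ℝ) ≤ k := k.cast_nonneg
  set ρ := β₂ / β₁ with hρ
  have hρ1 : 1 ≤ ρ := by rw [hρ, one_le_div hβ₁]; exact hβ.le
  have hρ0 : 0 < ρ := by positivity
  set a : ℝ := (k : ℝ) / (2 * (k : ℝ) + 1) with ha
  set b : ℝ := 1 / (2 * (k : ℝ) + 1) with hb
  -- Chosen so that `m = ρ^q` satisfies `m^(1/2 + a) = ρ^(s - 1/2)`, which makes the weighted noise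
  -- terms equal.
  set q : ℝ := (s - 1 / 2) / (1 / 2 + a) with hq
  have ha0 : 0 ≤ a := by positivity
  have ha2 : 1 / 2 + a = (4 * k + 1) / (2 * (2 * k + 1)) := by rw [ha]; field_simp; ring
  have hqe : q = (2 * s - 1) * (2 * k + 1) / (4 * k + 1) := by
    rw [hq, ha2]; field_simp
  rw [div_le_iff₀ (by positivity)] at hs₁
  rw [le_div_iff₀ (by positivity)] at hs₂
  -- The kinetic condition, equivalent to the upper bound on `s`.
  have hexp1 : q * 2 ≤ s := by
    rw [hqe, div_mul_eq_mul_div, div_le_iff₀ (by positivity)]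
    nlinarith
  -- The potential condition, equivalent to the lower bound on `s`.
  have hexp2 : q * (-b) ≤ s := by
    have : q * (-b) = (1 - 2 * s) / (4 * k + 1) := by rw [hqe, hb]; field_simp; ring
    rw [this, div_le_iff₀ (by positivity)]
    nlinarith
  have hm0 : 0 < ρ ^ q := Real.rpow_pos_of_pos hρ0 q
  refine ⟨⟨ρ ^ q, hm0.le⟩, hm0, fun w => ?_⟩
  set m : ℝ≥0 := ⟨ρ ^ q, hm0.le⟩ with hm
  have hmpos : 0 < m := hm0
  have hmpos' : (0 : ℝ) < m := hm0
  have hmc : (m : ℝ) = ρ ^ q := rfl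
  have hm2 : (m : ℝ) ^ 2 ≤ ρ ^ s := by
    rw [hmc, ← Real.rpow_natCast, ← Real.rpow_mul hρ0.le]
    exact Real.rpow_le_rpow_of_exponent_le hρ1 (by exact_mod_cast hexp1)
  have hmb : (m : ℝ) ^ (-b) ≤ ρ ^ s := by
    rw [hmc, ← Real.rpow_mul hρ0.le]
    exact Real.rpow_le_rpow_of_exponent_le hρ1 hexp2
  have hmn : (m : ℝ) ^ (1 / 2 + a) = ρ ^ s / √ρ := by
    have : q * (1 / 2 + a) = s - 1 / 2 := by rw [hq]; field_simp
    rw [hmc, ← Real.rpow_mul hρ0.le, this, Real.rpow_sub hρ0, Real.sqrt_eq_rpow]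
  have hβs : β₂ ^ s = β₁ ^ s * ρ ^ s := by
    rw [← Real.mul_rpow hβ₁.le hρ0.le, hρ, mul_div_cancel₀ _ hβ₁.ne']
  have hβr : √β₂ = √β₁ * √ρ := by
    rw [← Real.sqrt_mul hβ₁.le, hρ, mul_div_cancel₀ _ hβ₁.ne']
  have hp1 : 0 < β₁ ^ s := Real.rpow_pos_of_pos hβ₁ s
  have hp2 : 0 < β₂ ^ s := Real.rpow_pos_of_pos hβ₂ s
  rw [mul_comm, ← EReal.le_div_iff_mul_le (by exact_mod_cast hp2) (EReal.coe_ne_top _)]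
  refine iSup_le fun f => iSup_le fun hf => iSup_le fun hf1 => iSup_le fun c => iSup_le fun hc => ?_
  rw [EReal.le_div_iff_mul_le (by exact_mod_cast hp2) (EReal.coe_ne_top _)]
  have hle : ((2 / √β₁ * ((m : ℝ) ^ (1 / 2 + a) * c) - energy k (dilate m f) : ℝ) : EReal) ≤
      higherTW k β₁ (rescale m w) :=
    le_iSup_of_le (dilate m f) (le_iSup_of_le (hf.dilate hm0)
      (le_iSup_of_le ((integral_dilate_sq hm0 f).trans hf1)
      (le_iSup₂_of_le _ (HasWienerIntegral.dilate hmpos hc) le_rfl)))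
  refine le_trans ?_ (mul_le_mul_of_nonneg_left hle (by exact_mod_cast hp1.le))
  rw [← EReal.coe_mul, ← EReal.coe_mul, EReal.coe_le_coe_iff, energy_dilate hf hmpos', hf.energy_eq,
    hmn, hβs, hβr]
  have hK : 0 ≤ ∫ x in Ioi (0 : ℝ), deriv f x ^ 2 := integral_nonneg fun x => sq_nonneg _
  have hV : 0 ≤ ∫ x in Ioi (0 : ℝ), x ^ b * f x ^ 2 :=
    setIntegral_nonneg measurableSet_Ioi fun x hx => by
      have : (0 : ℝ) < x := hx
      positivity
  set K := ∫ x in Ioi (0 : ℝ), deriv f x ^ 2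
  set V := ∫ x in Ioi (0 : ℝ), x ^ b * f x ^ 2
  have e1 := mul_le_mul_of_nonneg_right hm2 hK
  have e2 := mul_le_mul_of_nonneg_right hmb hV
  have e3 : 2 / √β₁ * (ρ ^ s / √ρ * c) = 2 / (√β₁ * √ρ) * c * ρ ^ s := by
    have : √ρ ≠ 0 := (Real.sqrt_pos.2 hρ0).ne'
    have : √β₁ ≠ 0 := (Real.sqrt_pos.2 hβ₁).ne'
    field_simp
  rw [e3, mul_comm, mul_assoc]
  refine mul_le_mul_of_nonneg_left ?_ hp1.le
  nlinarith
theorem theorem3 {Ω₁ Ω₂ : Type*} [MeasurableSpace Ω₁] [MeasurableSpace Ω₂]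
    (P₁ : Measure Ω₁) (P₂ : Measure Ω₂) (W₁ : ℝ≥0 → Ω₁ → ℝ) (W₂ : ℝ≥0 → Ω₂ → ℝ)
    (hW₁ : IsBrownianReal W₁ P₁) (hW₂ : IsBrownianReal W₂ P₂)
    (k : ℕ) (β₁ β₂ s : ℝ) (hβ₁ : 0 < β₁) (hβ : β₁ < β₂)
    (hs₁ : 1 / (4 * (k : ℝ) + 3) ≤ s) (hs₂ : s ≤ (4 * (k : ℝ) + 2) / (4 * (k : ℝ) + 3)) :
    StochDominates
      (fun ω => ((β₁ ^ s : ℝ) : EReal) * higherTW k β₁ (fun x => W₁ x ω)) P₁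
      (fun ω => ((β₂ ^ s : ℝ) : EReal) * higherTW k β₂ (fun x => W₂ x ω)) P₂ := by
  obtain ⟨m, hm, hle⟩ := exists_rescale_mul_higherTW_le k hβ₁ hβ hs₁ hs₂
  refine ⟨aemeasurable_mul_higherTW hW₁ k β₁ _, aemeasurable_mul_higherTW hW₂ k β₂ _, fun t => ?_⟩
  -- Replacing `W₁` by the rescaled `W₂` puts both sides on one probability space, where the
  -- pathwise inequality gives an inclusion of events.
  rw [measure_lt_mul_higherTW_eq hW₁ (hW₂.smul hm.ne') k β₁ _ t]
  exact measure_mono fun ω hω => lt_of_lt_of_le hω (hle fun x => W₂ x ω)
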